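/- Let $R$ be a noetherian commutative ring, $n\ge 0$, and let $I$ be an ideal of $R[[t]][x_1,\dots,x_n]$ that is $x$-homogeneous, i.e. generated by elements that are homogeneous in $x_1,\dots,x_n$ over $R[[t]]$. For $f=\sum c_{\beta,\alpha}t^\beta x^\alpha$ and $v\in\mathbb R_{<0}\times\mathbb R^n$ let $\mathrm{in}_v(f)\in R[t,x]$ be the sum of the terms $c_{\beta,\alpha}t^\beta x^\alpha$ of $f$ with $v\cdot(\beta,\alpha)$ maximal, and let $\mathrm{in}_v(I)\subseteq R[t,x]$ be the ideal generated by all $\mathrm{in}_v(f)$, $f\in I$. For $w\in\mathbb R_{<0}\times\mathbb R^n$ put $$C_w(I)=\overline{\{v\in\mathbb R_{<0}\times\mathbb R^n:\ \mathrm{in}_v(I)=\mathrm{in}_w(I)\}},\qquad C_w^0(I)=C_w(I)\cap(\{0\}\times\mathbb R^n),$$ with the closure taken in the Euclidean topology of $\mathbb R^{n+1}$. Then, for every $w\in\mathbb R_{<0}\times\mathbb R^n$, $C_w(I)$ and $C_w^0(I)$ are closed rational polyhedral cones, i.e. closed sets that are solution sets of finitely many homogeneous linear inequalities with integer coefficients.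 Moreover, let $>$ be any monomial ordering on the monomials $t^\beta x^\alpha$ (a total ordering compatible with multiplication, not necessarily a well-ordering), and let $>_w$ be the ordering that compares monomials first by $w\cdot(\beta,\alpha)$ and then by $>$. Write $\mathrm{lm}(f)$ and $\mathrm{lt}(f)$ for the $>_w$-greatest monomial of $f\neq0$ and the corresponding term, and $\mathrm{lt}(0)=0$; $\mathrm{lt}(I)\subseteq R[t,x]$ is the ideal generated by the $\mathrm{lt}(f)$, $f\in I$. For $g\in R[[t]][x]$ let $\Lambda(g)$ be the finite set of those $(\beta,\alpha)$ for which $t^\beta x^\alpha$ occurs in $g$ and $\beta$ is the least power of $t$ in the coefficient of $x^\alpha$ in $g$. An initially reduced standard basis of $I$ with respect to $>_w$ is a finite set $G\subseteq I$ such that $\{\mathrm{lt}(g):g\in G\}$ generates $\mathrm{lt}(I)$, no proper subset of $\{\mathrm{lt}(g):g\in G\}$ does, and for every $g\in G$ no term of $g$ with exponent in $\Lambda(g)$ other than $\mathrm{lt}(g)$ lies in $\mathrm{lt}(I)$. Such a $G$ exists, and for every such $G$ the cone $C_w(I)$ is the set of all $v\in\mathbb R_{\le0}\times\mathbb R^n$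 such that for all $g\in G$, with $\mathrm{lm}(g)=t^\delta x^\gamma$, $$v\cdot(\delta,\gamma)\ \ge\ v\cdot(\beta,\alpha)\quad\text{for all }(\beta,\alpha)\in\Lambda(g),$$ $$v\cdot(\beta,\alpha)=v\cdot(\beta',\alpha')\quad\text{for all exponents }(\beta,\alpha),(\beta',\alpha')\text{ of terms of }\mathrm{in}_w(g),$$ and $C_w^0(I)$ is the set of all $v\in\{0\}\times\mathbb R^n$ satisfying these same conditions. -/

import Mathlib

open scoped PowerSeries Polynomial

noncomputable section

namespace GroebnerFan

/-- Exponent vectors `(β, α)` of the monomials `t ^ β * x ^ α` in `t, x₁, …, xₙ`. Multiplication of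
monomials is addition of exponent vectors. -/
abbrev Mon (n : ℕ) : Type := ℕ × (Fin n →₀ ℕ)

/-- The mixed power series polynomial ring `R⟦t⟧[x₁, …, xₙ]`. -/
abbrev MixedRing (R : Type*) [CommRing R] (n : ℕ) : Type _ := MvPolynomial (Fin n) R⟦X⟧

/-- The polynomial ring `R[t, x₁, …, xₙ]`, written as `R[t][x₁, …, xₙ]`. -/
abbrev PolyRing (R : Type*) [CommRing R] (n : ℕ) : Type _ := MvPolynomial (Fin n) R[X]

/-- The space `ℝ × ℝⁿ` of weight vectors `(w₀, (w₁, …, wₙ))`; `w₀` is the weight of `t`. -/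
abbrev Weight (n : ℕ) : Type := ℝ × (Fin n → ℝ)

/-- The weighted degree `w · (β, α)`. -/
def wdeg {n : ℕ} (w : Weight n) (p : Mon n) : ℝ :=
  w.1 * (p.1 : ℝ) + ∑ i, w.2 i * (p.2 i : ℝ)

variable {R : Type*} [CommRing R] {n : ℕ}

/-- The coefficient of `t ^ β * x ^ α` in an element of `R⟦t⟧[x]`. -/
def tcoeff (f : MixedRing R n) (p : Mon n) : R :=
  PowerSeries.coeff p.1 (MvPolynomial.coeff p.2 f)

/-- The term `c * t ^ β * x ^ α` in `R[t, x]`. -/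
def term (p : Mon n) (c : R) : PolyRing R n :=
  MvPolynomial.monomial p.2 (Polynomial.monomial p.1 c)

open Classical in
/-- The finite set of exponents `(β, α)` such that `x ^ α` occurs in `f` and `β` is the least power
of `t` occurring in its coefficient. -/
def minExps (f : MixedRing R n) : Finset (Mon n) :=
  f.support.image fun α => ((PowerSeries.order (MvPolynomial.coeff α f)).toNat, α)

open Classical in
/-- The exponents of the monomials of `f` that are greatest with respect to `le` among all monomials
of `f`. As soon as `t * m` is strictly smaller than `m` for every monomial `m`, a greatest monomial
lies in `minExps f`; see `mem_topExps`. -/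
def topExps (le : Mon n → Mon n → Prop) (f : MixedRing R n) : Finset (Mon n) :=
  (minExps f).filter fun p => ∀ q, tcoeff f q ≠ 0 → le q p

/-- The sum of the terms of `f` whose monomials are greatest with respect to `le`. -/
def topForm (le : Mon n → Mon n → Prop) (f : MixedRing R n) : PolyRing R n :=
  ∑ p ∈ topExps le f, term p (tcoeff f p)

theorem mem_minExps (f : MixedRing R n) (p : Mon n) :
    p ∈ minExps f ↔ tcoeff f p ≠ 0 ∧ ∀ b < p.1, tcoeff f (b, p.2) = 0 := by
  obtain ⟨β, α⟩ := p
  simp only [minExps, tcoeff, Finset.mem_image, MvPolynomial.mem_support_iff, Prod.mk.injEq]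
  constructor
  · rintro ⟨α', h, hβ, rfl⟩
    subst hβ
    refine ⟨PowerSeries.coeff_order h, fun b hb => PowerSeries.coeff_of_lt_order_toNat b hb⟩
  · rintro ⟨h, hlt⟩
    have h0 : MvPolynomial.coeff α f ≠ 0 := by
      intro h0
      simp [h0] at h
    refine ⟨α, h0, ?_, rfl⟩
    have : PowerSeries.order (MvPolynomial.coeff α f) = (β : ℕ∞) :=
      PowerSeries.order_eq_nat.2 ⟨h, hlt⟩
    simp [this]

theorem mem_topExps {le : Mon n → Mon n → Prop}
    (hle : ∀ (b β : ℕ) (α : Fin n →₀ ℕ), b < β → ¬ le (b, α) (β, α))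
    (f : MixedRing R n) (p : Mon n) :
    p ∈ topExps le f ↔ tcoeff f p ≠ 0 ∧ ∀ q, tcoeff f q ≠ 0 → le q p := by
  simp only [topExps, Finset.mem_filter, mem_minExps]
  constructor
  · rintro ⟨⟨h, -⟩, h2⟩
    exact ⟨h, h2⟩
  · rintro ⟨h, h2⟩
    refine ⟨⟨h, fun b hb => ?_⟩, h2⟩
    by_contra hne
    exact hle b p.1 p.2 hb (h2 _ hne)

/-- Comparison of monomials by their weighted degree. -/
def weightLe (w : Weight n) (p q : Mon n) : Prop := wdeg w p ≤ wdeg w q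

/-- The initial form `in_w(f)`. It is used for weights with `w₀ < 0` only. -/
def initialForm (w : Weight n) (f : MixedRing R n) : PolyRing R n := topForm (weightLe w) f

/-- The initial ideal `in_w(I)` in `R[t, x]`. -/
def initialIdeal (w : Weight n) (I : Ideal (MixedRing R n)) : Ideal (PolyRing R n) :=
  Ideal.span (initialForm w '' (I : Set (MixedRing R n)))

/-- A monomial ordering, given by its non-strict relation: a total order that is compatible with
multiplication of monomials. It need not be a well-ordering. -/
structure IsMonomialOrdering (le : Mon n → Mon n → Prop) : Prop where
  refl : ∀ a, le a a
  trans : ∀ a b c, le a b → le b c → le a c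
  antisymm : ∀ a b, le a b → le b a → a = b
  total : ∀ a b, le a b ∨ le b a
  add_right : ∀ a b c, le a b → le (a + c) (b + c)

/-- The weighted ordering `>_w` with tie breaker `le`. -/
def weightedOrder (w : Weight n) (le : Mon n → Mon n → Prop) (p q : Mon n) : Prop :=
  wdeg w p < wdeg w q ∨ (wdeg w p = wdeg w q ∧ le p q)

/-- The leading term `lt_>(f)`, with `lt_>(0) = 0`, for a monomial ordering with `t < 1`. For
`f ≠ 0` the finset `topExps le f` is the singleton of the leading monomial. -/
def leadTerm (le : Mon n → Mon n → Prop) (f : MixedRing R n) : PolyRing R n := topForm le f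

/-- The ideal `lt_>(H)` of `R[t, x]` generated by the leading terms of the elements of `H`. -/
def leadIdeal (le : Mon n → Mon n → Prop) (H : Set (MixedRing R n)) : Ideal (PolyRing R n) :=
  Ideal.span (leadTerm le '' H)

/-- An ideal of `R⟦t⟧[x]` is `x`-homogeneous if it is generated by `x`-homogeneous elements. -/
def IsXHomogeneous (I : Ideal (MixedRing R n)) : Prop :=
  ∃ S : Set (MixedRing R n), (∀ f ∈ S, ∃ d : ℕ, f.IsHomogeneous d) ∧ I = Ideal.span S

/-- `G` is a standard basis of `I`. -/
def IsStandardBasis (le : Mon n → Mon n → Prop) (I : Ideal (MixedRing R n))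
    (G : Finset (MixedRing R n)) : Prop :=
  (G : Set (MixedRing R n)) ⊆ I ∧
    leadIdeal le (G : Set (MixedRing R n)) = leadIdeal le (I : Set (MixedRing R n))

/-- No proper subset of the set of leading terms of `G` generates the leading ideal of `I`. -/
def IsMinimalFor (le : Mon n → Mon n → Prop) (I : Ideal (MixedRing R n))
    (G : Finset (MixedRing R n)) : Prop :=
  ∀ S : Set (PolyRing R n), S ⊂ leadTerm le '' (G : Set (MixedRing R n)) →
    Ideal.span S ≠ leadIdeal le (I : Set (MixedRing R n))

/-- For `g = ∑ g_α x ^ α` put `g' = ∑ lt(g_α) x ^ α`; the exponents of the terms of `g'` are those in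
`minExps g`. `G` is initially reduced with respect to `H` if, for every `g ∈ G`, no term of `g'`
other than the leading term lies in `lt_>(H)`. -/
def IsInitiallyReducedWrt (le : Mon n → Mon n → Prop) (G H : Finset (MixedRing R n)) : Prop :=
  ∀ g ∈ G, ∀ p ∈ minExps g, p ∉ topExps le g →
    term p (tcoeff g p) ∉ leadIdeal le (H : Set (MixedRing R n))

/-- `G` is an initially reduced standard basis of `I`. -/
def IsInitiallyReducedStandardBasis (le : Mon n → Mon n → Prop) (I : Ideal (MixedRing R n))
    (G : Finset (MixedRing R n)) : Prop :=
  IsStandardBasis le I G ∧ IsMinimalFor le I G ∧ IsInitiallyReducedWrt le G G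

/-- The interior Gröbner cone `C_w(I)`: the closure of the set of all weights `v` with `v₀ < 0` and
`in_v(I) = in_w(I)`. -/
def groebnerCone (I : Ideal (MixedRing R n)) (w : Weight n) : Set (Weight n) :=
  closure {v | v.1 < 0 ∧ initialIdeal v I = initialIdeal w I}

/-- The boundary Gröbner cone `C_w^0(I)`. -/
def boundaryGroebnerCone (I : Ideal (MixedRing R n)) (w : Weight n) : Set (Weight n) :=
  groebnerCone I w ∩ {v | v.1 = 0}

/-- A rational polyhedral cone in `ℝ × ℝⁿ`: the solution set of finitely many homogeneous linear
inequalities with integer coefficients. -/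
def IsRationalPolyhedralCone (C : Set (Weight n)) : Prop :=
  ∃ A : Finset (ℤ × (Fin n → ℤ)),
    C = {v | ∀ a ∈ A, 0 ≤ v.1 * (a.1 : ℝ) + ∑ i, v.2 i * (a.2 i : ℝ)}

/-- The conditions on a weight `v` read off from `G`: for each `g ∈ G` the leading monomial of `g`
with respect to `>_w` has `v`-degree at least that of every monomial in `minExps g`, and all
monomials of `in_w(g)` have the same `v`-degree. -/
def SatisfiesSystem (w : Weight n) (le : Mon n → Mon n → Prop) (G : Finset (MixedRing R n))
    (v : Weight n) : Prop :=
  ∀ g ∈ G,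
    (∀ m ∈ topExps (weightedOrder w le) g, ∀ p ∈ minExps g, wdeg v p ≤ wdeg v m) ∧
    (∀ p ∈ topExps (weightLe w) g, ∀ q ∈ topExps (weightLe w) g, wdeg v p = wdeg v q)

end GroebnerFan

end

open scoped PowerSeries Polynomial

noncomputable section

namespace GroebnerFan

variable {R : Type*} [CommRing R] {n : ℕ}

/-! The heart is `initialIdeal_eq_iff`: for `v.1 < 0`, the equality `in_v(I) = in_w(I)` holds
exactly when `in_v(g)` and `in_w(g)` have the same exponents for every `g` in an initially reduced
standard basis `G`. Such weights satisfy the closed system read off from `G`. Conversely, if `v`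
satisfies the system, every `v + ε • w` with `ε > 0` gives the exponents of `in_w(g)`
(`topExps_add_smul`), and these weights tend to `v`. This gives `groebnerCone_eq`.

In the pivot, equality of initial ideals puts `in_v(g)` and `in_v(g) - in_w(g)` into `in_w(I)`; a
discrepancy of exponents would then push a non-leading term of `g` with exponent in `minExps g` into
`lt(I)`, which reducedness forbids. Conversely, equal exponents make `G` a standard basis for `>_v`
too (`leadIdeal_eq_of_topExps_eq`), and initial forms of a homogeneous standard basis generate the
initial ideal (`initialIdeal_eq_span`).

Two obstacles shape the argument. Over a ring, leading coefficients cannot be divided out, so a term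
in the leading ideal is cancelled by an element of `I` with exactly that leading coefficient
(`exists_homogeneous_lift`). And `>_w` is not a well-ordering, so reduction is infinite: bounded
`x`-degree leaves only finitely many monomials above each one, the process converges `t`-adically,
and Krull's intersection theorem keeps the limit in `I` (`mem_of_forall_exists_congr`,
`exists_reduction`). -/

/-! ### Coefficients -/

/-- The coefficient of `t ^ β * x ^ α` in an element of `R[t][x]`. -/
def pcoeff (f : PolyRing R n) (p : Mon n) : R :=
  Polynomial.coeff (MvPolynomial.coeff p.2 f) p.1

/-- The term `c * t ^ β * x ^ α` in `R⟦t⟧[x]`. -/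
def mixedTerm (p : Mon n) (c : R) : MixedRing R n :=
  MvPolynomial.monomial p.2 (PowerSeries.C c * PowerSeries.X ^ p.1)

/-- The effect of multiplication by the term `c * t ^ β * x ^ α` on families of coefficients. -/
def shift (u : Mon n) (c : R) (F : Mon n → R) (q : Mon n) : R :=
  open Classical in if u ≤ q then c * F (q - u) else 0

@[simp] theorem tcoeff_zero (q : Mon n) : tcoeff (0 : MixedRing R n) q = 0 := by simp [tcoeff]

@[simp] theorem tcoeff_add (f g : MixedRing R n) (q : Mon n) :
    tcoeff (f + g) q = tcoeff f q + tcoeff g q := by simp [tcoeff]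

@[simp] theorem tcoeff_sub (f g : MixedRing R n) (q : Mon n) :
    tcoeff (f - g) q = tcoeff f q - tcoeff g q := by simp [tcoeff]

@[simp] theorem pcoeff_zero (q : Mon n) : pcoeff (0 : PolyRing R n) q = 0 := by simp [pcoeff]

@[simp] theorem pcoeff_add (f g : PolyRing R n) (q : Mon n) :
    pcoeff (f + g) q = pcoeff f q + pcoeff g q := by simp [pcoeff]

@[simp] theorem pcoeff_sub (f g : PolyRing R n) (q : Mon n) :
    pcoeff (f - g) q = pcoeff f q - pcoeff g q := by simp [pcoeff]

theorem pcoeff_sum {ι : Type*} (s : Finset ι) (f : ι → PolyRing R n) (q : Mon n) :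
    pcoeff (∑ i ∈ s, f i) q = ∑ i ∈ s, pcoeff (f i) q := by
  simp [pcoeff, MvPolynomial.coeff_sum, Polynomial.finsetSum_coeff]

theorem tcoeff_ext {f g : MixedRing R n} (h : ∀ q, tcoeff f q = tcoeff g q) : f = g := by
  refine MvPolynomial.ext _ _ fun α => PowerSeries.ext fun β => h (β, α)

theorem pcoeff_ext {f g : PolyRing R n} (h : ∀ q, pcoeff f q = pcoeff g q) : f = g := by
  refine MvPolynomial.ext _ _ fun α => Polynomial.ext fun β => h (β, α)

theorem exists_tcoeff_ne_zero {f : MixedRing R n} (hf : f ≠ 0) : ∃ q, tcoeff f q ≠ 0 := by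
  by_contra! h
  exact hf (tcoeff_ext fun q => by simp [h q])

theorem exists_pcoeff_ne_zero {f : PolyRing R n} (hf : f ≠ 0) : ∃ q, pcoeff f q ≠ 0 := by
  by_contra! h
  exact hf (pcoeff_ext fun q => by simp [h q])

open Classical in
theorem pcoeff_term (p q : Mon n) (c : R) : pcoeff (term p c) q = if p = q then c else 0 := by
  obtain ⟨β, α⟩ := p
  obtain ⟨β', α'⟩ := q
  by_cases h : α = α' <;> by_cases h' : β = β' <;>
    simp [pcoeff, term, MvPolynomial.coeff_monomial, Polynomial.coeff_monomial, h, h']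

theorem pcoeff_term_mul (u : Mon n) (c : R) (f : PolyRing R n) :
    pcoeff (term u c * f) = shift u c (pcoeff f) := by
  funext q
  obtain ⟨b, a⟩ := u
  obtain ⟨β, α⟩ := q
  by_cases h : a ≤ α <;> by_cases h' : b ≤ β <;>
    simp [pcoeff, term, shift, MvPolynomial.coeff_monomial_mul', h, h',
      ← Polynomial.C_mul_X_pow_eq_monomial, mul_assoc, Polynomial.coeff_X_pow_mul']

theorem tcoeff_mixedTerm_mul (u : Mon n) (c : R) (f : MixedRing R n) :
    tcoeff (mixedTerm u c * f) = shift u c (tcoeff f) := by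
  funext q
  obtain ⟨b, a⟩ := u
  obtain ⟨β, α⟩ := q
  by_cases h : a ≤ α <;> by_cases h' : b ≤ β <;>
    simp [tcoeff, mixedTerm, shift, MvPolynomial.coeff_monomial_mul', h, h',
      mul_assoc, PowerSeries.coeff_X_pow_mul']

theorem shift_ne_zero {u : Mon n} {c : R} {F : Mon n → R} {q : Mon n} (h : shift u c F q ≠ 0) :
    ∃ q', q = q' + u ∧ F q' ≠ 0 := by
  unfold shift at h
  split_ifs at h with hu
  · exact ⟨q - u, (tsub_add_cancel_of_le hu).symm, fun h0 => h (by simp [h0])⟩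
  · exact absurd rfl h

theorem polyRing_induction {P : PolyRing R n → Prop} (hadd : ∀ a b, P a → P b → P (a + b))
    (hterm : ∀ u c, P (term u c)) (a : PolyRing R n) : P a := by
  induction a using MvPolynomial.induction_on' with
  | monomial u a =>
    induction a using Polynomial.induction_on' with
    | add a b ha hb => rw [map_add]; exact hadd _ _ ha hb
    | monomial k c => exact hterm (k, u) c
  | add a b ha hb => exact hadd _ _ ha hb

theorem finite_pcoeff_support (p : PolyRing R n) : {q | pcoeff p q ≠ 0}.Finite := by
  induction p using polyRing_induction with
  | hadd a b ha hb =>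
    refine (ha.union hb).subset fun q hq => ?_
    by_contra h
    simp only [Set.mem_union, Set.mem_ofPred_eq, not_or, not_not] at h
    exact hq (by simp [h.1, h.2])
  | hterm u c =>
    refine (Set.finite_singleton u).subset fun q hq => ?_
    classical
    by_contra h
    exact hq (by rw [pcoeff_term, if_neg (Ne.symm h)])

/-! ### Preorders on monomials -/

/-- Total preorders on monomials that are compatible with multiplication and satisfy `t < 1`. -/
structure IsTermPreorder (le : Mon n → Mon n → Prop) : Prop where
  refl : ∀ a, le a a
  trans : ∀ a b c, le a b → le b c → le a c
  total : ∀ a b, le a b ∨ le b a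
  add_iff : ∀ a b c, le (a + c) (b + c) ↔ le a b
  t_lt : ∀ (b β : ℕ) (α : Fin n →₀ ℕ), b < β → ¬ le (b, α) (β, α)

theorem wdeg_add (w : Weight n) (p q : Mon n) : wdeg w (p + q) = wdeg w p + wdeg w q := by
  simp only [wdeg, Prod.fst_add, Prod.snd_add, Finsupp.add_apply, Nat.cast_add, mul_add,
    Finset.sum_add_distrib]
  ring

theorem wdeg_t_lt {w : Weight n} (hw : w.1 < 0) {b β : ℕ} (α : Fin n →₀ ℕ) (h : b < β) :
    wdeg w (β, α) < wdeg w (b, α) := by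
  simp only [wdeg, add_lt_add_iff_right]
  exact mul_lt_mul_of_neg_left (by exact_mod_cast h) hw

theorem isTermPreorder_weightLe {w : Weight n} (hw : w.1 < 0) : IsTermPreorder (weightLe w) where
  refl _ := le_refl (wdeg w _)
  trans _ _ _ := le_trans (α := ℝ)
  total _ _ := le_total (α := ℝ) _ _
  add_iff a b c := by simp [weightLe, wdeg_add]
  t_lt b β α h := not_le.2 (wdeg_t_lt hw α h)

theorem IsMonomialOrdering.add_iff {le : Mon n → Mon n → Prop} (hle : IsMonomialOrdering le)
    (a b c : Mon n) : le (a + c) (b + c) ↔ le a b := by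
  refine ⟨fun h => ?_, hle.add_right a b c⟩
  rcases hle.total a b with h' | h'
  · exact h'
  · have := add_right_cancel (hle.antisymm _ _ h (hle.add_right _ _ c h'))
    exact this ▸ hle.refl _

theorem isTermPreorder_weightedOrder {w : Weight n} (hw : w.1 < 0) {le : Mon n → Mon n → Prop}
    (hle : IsMonomialOrdering le) : IsTermPreorder (weightedOrder w le) where
  refl a := Or.inr ⟨rfl, hle.refl a⟩
  trans a b c := by
    rintro (h | ⟨h, h'⟩) (k | ⟨k, k'⟩)
    · exact Or.inl (h.trans k)
    · exact Or.inl (k ▸ h)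
    · exact Or.inl (h ▸ k)
    · exact Or.inr ⟨h.trans k, hle.trans _ _ _ h' k'⟩
  total a b := by
    rcases lt_trichotomy (wdeg w a) (wdeg w b) with h | h | h
    · exact Or.inl (Or.inl h)
    · rcases hle.total a b with h' | h'
      · exact Or.inl (Or.inr ⟨h, h'⟩)
      · exact Or.inr (Or.inr ⟨h.symm, h'⟩)
    · exact Or.inr (Or.inl h)
  add_iff a b c := by simp [weightedOrder, wdeg_add, hle.add_iff]
  t_lt b β α h := by
    have := wdeg_t_lt hw α h
    rintro (h' | ⟨h', -⟩)
    · exact lt_asymm h' this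
    · exact this.ne' h'

theorem weightedOrder_antisymm {w : Weight n} {le : Mon n → Mon n → Prop}
    (hle : IsMonomialOrdering le) {a b : Mon n} (h : weightedOrder w le a b)
    (h' : weightedOrder w le b a) : a = b := by
  rcases h with h | ⟨h, k⟩ <;> rcases h' with h' | ⟨h', k'⟩
  · exact absurd h' (lt_asymm h)
  · exact absurd h' h.ne'
  · exact absurd h h'.ne'
  · exact hle.antisymm _ _ k k'

theorem weightLe_of_weightedOrder {w : Weight n} {le : Mon n → Mon n → Prop} {a b : Mon n}
    (h : weightedOrder w le a b) : weightLe w a b := by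
  rcases h with h | h
  · exact h.le
  · exact h.1.le

namespace IsTermPreorder

variable {le : Mon n → Mon n → Prop}

theorem exists_greatest (hle : IsTermPreorder le) (s : Finset (Mon n)) (hs : s.Nonempty) :
    ∃ m ∈ s, ∀ q ∈ s, le q m := by
  induction hs using Finset.Nonempty.cons_induction with
  | singleton a => exact ⟨a, by simp, by simpa using hle.refl a⟩
  | cons a s ha hs ih =>
    obtain ⟨m, hm, hmax⟩ := ih
    rcases hle.total a m with h | h
    · refine ⟨m, by simp [hm], fun q hq => ?_⟩
      rcases Finset.mem_cons.1 hq with rfl | hq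
      exacts [h, hmax q hq]
    · refine ⟨a, by simp, fun q hq => ?_⟩
      rcases Finset.mem_cons.1 hq with rfl | hq
      exacts [hle.refl _, hle.trans _ _ _ (hmax q hq) h]

theorem mem_topExps (hle : IsTermPreorder le) {f : MixedRing R n} {p : Mon n} :
    p ∈ topExps le f ↔ tcoeff f p ≠ 0 ∧ ∀ q, tcoeff f q ≠ 0 → le q p :=
  GroebnerFan.mem_topExps hle.t_lt f p

theorem exists_minExps_ge (hle : IsTermPreorder le) {f : MixedRing R n} {q : Mon n}
    (hq : tcoeff f q ≠ 0) : ∃ p ∈ minExps f, p.2 = q.2 ∧ p.1 ≤ q.1 ∧ le q p := by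
  classical
  have hex : ∃ b, tcoeff f (b, q.2) ≠ 0 := ⟨q.1, hq⟩
  have hmin : Nat.find hex ≤ q.1 := Nat.find_min' hex hq
  refine ⟨(Nat.find hex, q.2), (mem_minExps _ _).2 ⟨Nat.find_spec hex, fun b hb => ?_⟩,
    rfl, hmin, ?_⟩
  · exact not_not.1 (Nat.find_min hex hb)
  · rcases hmin.eq_or_lt with h | h
    · rw [h]
      exact hle.refl _
    · exact (hle.total _ _).resolve_right (hle.t_lt _ _ _ h)

theorem topExps_nonempty (hle : IsTermPreorder le) {f : MixedRing R n} (hf : f ≠ 0) :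
    (topExps le f).Nonempty := by
  obtain ⟨q, hq⟩ := exists_tcoeff_ne_zero hf
  obtain ⟨p, hp, -⟩ := hle.exists_minExps_ge hq
  obtain ⟨m, hm, hmax⟩ := hle.exists_greatest (minExps f) ⟨p, hp⟩
  refine ⟨m, hle.mem_topExps.2 ⟨((mem_minExps _ _).1 hm).1, fun q' hq' => ?_⟩⟩
  obtain ⟨p', hp', -, -, h⟩ := hle.exists_minExps_ge hq'
  exact hle.trans _ _ _ h (hmax p' hp')

end IsTermPreorder

theorem topExps_subset_minExps (le : Mon n → Mon n → Prop) (f : MixedRing R n) :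
    topExps le f ⊆ minExps f := by
  classical
  exact Finset.filter_subset _ _

open Classical in
theorem pcoeff_topForm (le : Mon n → Mon n → Prop) (f : MixedRing R n) (q : Mon n) :
    pcoeff (topForm le f) q = if q ∈ topExps le f then tcoeff f q else 0 := by
  simp [topForm, pcoeff_sum, pcoeff_term]

/-! ### Lifting elements of ideals generated by top forms -/

/-- If the generators of an ideal of `R[t, x]` agree, on each equivalence class of monomials, with
a member of a family that is closed under addition and multiplication by terms, then so do all
elements of the ideal. -/
theorem exists_lift_of_mem_span {le : Mon n → Mon n → Prop} (hle : IsTermPreorder le)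
    (P : Mon n → (Mon n → R) → Prop) (hzero : ∀ q, P q 0)
    (hadd : ∀ q F F', P q F → P q F' → P q (F + F'))
    (hshift : ∀ q u c F, P q F → P (q + u) (shift u c F))
    (hequiv : ∀ q q' F, le q q' → le q' q → P q F → P q' F)
    {T : Set (PolyRing R n)}
    (hT : ∀ τ ∈ T, ∀ q₀, ∃ F, P q₀ F ∧ ∀ q, le q q₀ → le q₀ q → F q = pcoeff τ q)
    {p : PolyRing R n} (hp : p ∈ Ideal.span T) (q₀ : Mon n) :
    ∃ F, P q₀ F ∧ ∀ q, le q q₀ → le q₀ q → F q = pcoeff p q := by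
  induction hp using Submodule.span_induction generalizing q₀ with
  | mem τ hτ => exact hT τ hτ q₀
  | zero => exact ⟨0, hzero _, fun q _ _ => by simp⟩
  | add a b _ _ iha ihb =>
    obtain ⟨F, hF, hF'⟩ := iha q₀
    obtain ⟨F₂, hF₂, hF₂'⟩ := ihb q₀
    exact ⟨F + F₂, hadd _ _ _ hF hF₂, fun q h h' => by simp [hF' q h h', hF₂' q h h']⟩
  | smul a x _ ih =>
    induction a using polyRing_induction generalizing q₀ with
    | hadd a b iha ihb =>
      obtain ⟨F, hF, hF'⟩ := iha q₀
      obtain ⟨F₂, hF₂, hF₂'⟩ := ihb q₀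
      exact ⟨F + F₂, hadd _ _ _ hF hF₂, fun q h h' => by
        simp [hF' q h h', hF₂' q h h', add_mul]⟩
    | hterm u c =>
      -- If no multiple of `u` is equivalent to `q₀`, the product vanishes on the class and `0`
      -- lifts it. Otherwise any such `q₁` serves, since multiplication by `u` preserves and
      -- reflects `le`.
      by_cases hex : ∃ q₁, le (q₁ + u) q₀ ∧ le q₀ (q₁ + u)
      · obtain ⟨q₁, h₁, h₂⟩ := hex
        obtain ⟨F, hF, hF'⟩ := ih q₁
        refine ⟨shift u c F, hequiv _ _ _ h₁ h₂ (hshift _ _ _ _ hF), fun q h h' => ?_⟩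
        rw [smul_eq_mul, pcoeff_term_mul]
        unfold shift
        split_ifs with hu
        · rw [hF' (q - u)]
          · rw [← hle.add_iff _ _ u, tsub_add_cancel_of_le hu]
            exact hle.trans _ _ _ h h₂
          · rw [← hle.add_iff _ _ u, tsub_add_cancel_of_le hu]
            exact hle.trans _ _ _ h₁ h'
        · rfl
      · refine ⟨0, hzero _, fun q h h' => ?_⟩
        by_contra hne
        rw [smul_eq_mul, pcoeff_term_mul] at hne
        obtain ⟨q', rfl, -⟩ := shift_ne_zero (Ne.symm hne)
        exact hex ⟨q', h, h'⟩

/-- On each equivalence class of monomials, an element of the ideal generated by the top forms of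
the elements of `I` agrees with some `f ∈ I` having no greater monomials. -/
theorem exists_mem_of_mem_span_topForm {le : Mon n → Mon n → Prop} (hle : IsTermPreorder le)
    {I : Ideal (MixedRing R n)} {p : PolyRing R n}
    (hp : p ∈ Ideal.span (topForm le '' (I : Set (MixedRing R n)))) (q₀ : Mon n) :
    ∃ f ∈ I, (∀ q, tcoeff f q ≠ 0 → le q q₀) ∧
      ∀ q, le q q₀ → le q₀ q → tcoeff f q = pcoeff p q := by
  obtain ⟨F, ⟨f, hf, rfl, hfq⟩, h⟩ := exists_lift_of_mem_span hle
    (fun q₀ F => ∃ f ∈ I, tcoeff f = F ∧ ∀ q, F q ≠ 0 → le q q₀)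
    (fun q => ⟨0, I.zero_mem, by funext q; simp, by simp⟩)
    (by
      rintro q _ _ ⟨f, hf, rfl, h⟩ ⟨f', hf', rfl, h'⟩
      refine ⟨f + f', I.add_mem hf hf', by funext q; simp, fun q' hq' => ?_⟩
      by_cases h0 : tcoeff f q' = 0
      · exact h' q' fun h0' => hq' (by simp [h0, h0'])
      · exact h q' h0)
    (by
      rintro q u c _ ⟨f, hf, rfl, h⟩
      refine ⟨mixedTerm u c * f, I.mul_mem_left _ hf, tcoeff_mixedTerm_mul u c f, fun q' hq' => ?_⟩
      obtain ⟨q'', rfl, hq''⟩ := shift_ne_zero hq'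
      exact (hle.add_iff _ _ _).2 (h q'' hq''))
    (by
      rintro q q' _ h h' ⟨f, hf, rfl, hf'⟩
      exact ⟨f, hf, rfl, fun q'' hq'' => hle.trans _ _ _ (hf' q'' hq'') h⟩)
    (by
      rintro _ ⟨f, hf, rfl⟩ q₀
      -- The top monomials of `f` form one class within its support: if it is the class of `q₀`,
      -- then `f` is its own lift; if not, `0` is.
      by_cases hex : ∃ q ∈ topExps le f, le q q₀ ∧ le q₀ q
      · obtain ⟨m, hm, h₁, h₂⟩ := hex
        have hm' := hle.mem_topExps.1 hm
        refine ⟨tcoeff f, ⟨f, hf, rfl, fun q hq => hle.trans _ _ _ (hm'.2 q hq) h₁⟩,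
          fun q h h' => ?_⟩
        rw [pcoeff_topForm]
        split_ifs with hq
        · rfl
        · by_contra hne
          exact hq (hle.mem_topExps.2 ⟨hne, fun q' hq' =>
            hle.trans _ _ _ (hm'.2 q' hq') (hle.trans _ _ _ h₁ h')⟩)
      · refine ⟨0, ⟨0, I.zero_mem, by funext q; simp, by simp⟩, fun q h h' => ?_⟩
        rw [pcoeff_topForm, if_neg fun hq => hex ⟨q, hq, h, h'⟩]
        rfl)
    hp q₀
  exact ⟨f, hf, hfq, h⟩

/-- Total orders on monomials that are compatible with multiplication and satisfy `t < 1`. -/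
structure IsTermOrder (le : Mon n → Mon n → Prop) : Prop extends IsTermPreorder le where
  antisymm : ∀ a b, le a b → le b a → a = b

theorem isTermOrder_weightedOrder {w : Weight n} (hw : w.1 < 0) {le : Mon n → Mon n → Prop}
    (hle : IsMonomialOrdering le) : IsTermOrder (weightedOrder w le) where
  toIsTermPreorder := isTermPreorder_weightedOrder hw hle
  antisymm _ _ := weightedOrder_antisymm hle

namespace IsTermOrder

variable {le : Mon n → Mon n → Prop}

theorem topExps_eq_singleton (hle : IsTermOrder le) {f : MixedRing R n} {m : Mon n}
    (hm : m ∈ topExps le f) : topExps le f = {m} := by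
  refine Finset.eq_singleton_iff_unique_mem.2 ⟨hm, fun q hq => ?_⟩
  rw [hle.mem_topExps] at hm hq
  exact hle.antisymm _ _ (hm.2 q hq.1) (hq.2 m hm.1)

theorem leadTerm_eq (hle : IsTermOrder le) {f : MixedRing R n} {m : Mon n}
    (hm : m ∈ topExps le f) : leadTerm le f = term m (tcoeff f m) := by
  simp [leadTerm, topForm, hle.topExps_eq_singleton hm]

theorem term_mem_leadIdeal (hle : IsTermOrder le) {H : Set (MixedRing R n)} {f : MixedRing R n}
    (hf : f ∈ H) {m : Mon n} (hm : m ∈ topExps le f) : term m (tcoeff f m) ∈ leadIdeal le H := by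
  rw [← hle.leadTerm_eq hm]
  exact Ideal.subset_span ⟨f, hf, rfl⟩

end IsTermOrder

/-! ### Homogeneity in `x` -/

theorem IsXHomogeneous.homogeneousComponent_mem {I : Ideal (MixedRing R n)} (hI : IsXHomogeneous I)
    {f : MixedRing R n} (hf : f ∈ I) (d : ℕ) : MvPolynomial.homogeneousComponent d f ∈ I := by
  obtain ⟨S, hS, rfl⟩ := hI
  let _ := MvPolynomial.gradedAlgebra (σ := Fin n) (R := R⟦X⟧)
  refine MvPolynomial.homogeneousComponent_mem_of_mem
    (Ideal.homogeneous_span (MvPolynomial.homogeneousSubmodule (Fin n) R⟦X⟧) S fun x hx => ?_) hf d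
  obtain ⟨d, hd⟩ := hS x hx
  exact ⟨d, hd⟩

theorem tcoeff_homogeneousComponent (f : MixedRing R n) (d : ℕ) (q : Mon n) :
    tcoeff (MvPolynomial.homogeneousComponent d f) q = if q.2.degree = d then tcoeff f q else 0 := by
  unfold tcoeff
  rw [MvPolynomial.coeff_homogeneousComponent]
  split_ifs <;> simp

/-- This replaces division by a leading coefficient: sums and term multiples of leading terms lift
to `I` with the exact coefficient, and passing to the homogeneous component of the degree of `q`
keeps it. -/
theorem exists_homogeneous_lift {le : Mon n → Mon n → Prop} (hle : IsTermPreorder le)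
    {I : Ideal (MixedRing R n)} (hI : IsXHomogeneous I) {q : Mon n} {c : R}
    (h : term q c ∈ leadIdeal le (I : Set (MixedRing R n))) :
    ∃ f ∈ I, tcoeff f q = c ∧ ∀ p, tcoeff f p ≠ 0 → le p q ∧ p.2.degree = q.2.degree := by
  classical
  obtain ⟨f, hf, hfq, hc⟩ := exists_mem_of_mem_span_topForm hle h q
  refine ⟨_, hI.homogeneousComponent_mem hf q.2.degree, ?_, fun p hp => ?_⟩
  · rw [tcoeff_homogeneousComponent, if_pos rfl, hc q (hle.refl q) (hle.refl q), pcoeff_term,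
      if_pos rfl]
  · rw [tcoeff_homogeneousComponent] at hp
    split_ifs at hp with hd
    · exact ⟨hfq p hp, hd⟩
    · exact absurd rfl hp

theorem exists_degree_bound (f : MixedRing R n) :
    ∃ D, ∀ q, tcoeff f q ≠ 0 → q.2.degree ≤ D := by
  refine ⟨f.support.sup Finsupp.degree, fun q hq => Finset.le_sup (f := Finsupp.degree) ?_⟩
  rw [MvPolynomial.mem_support_iff]
  intro h
  exact hq (by simp [tcoeff, h])

theorem finite_degree_le (n D : ℕ) : {α : Fin n →₀ ℕ | α.degree ≤ D}.Finite :=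
  Finsupp.finite_of_degree_le D

theorem finite_degree_le_of_lt (n D N : ℕ) : {q : Mon n | q.2.degree ≤ D ∧ q.1 < N}.Finite :=
  ((Set.finite_Iio N).prod (finite_degree_le n D)).subset fun _ h => ⟨h.2, h.1⟩

/-- In bounded `x`-degree, only finitely many monomials are at least as big as a given one. -/
theorem finite_degree_le_of_weightLe {w : Weight n} (hw : w.1 < 0) (D : ℕ) (q : Mon n) :
    {p : Mon n | p.2.degree ≤ D ∧ weightLe w q p}.Finite := by
  have hfin : ∀ α : Fin n →₀ ℕ, {p : Mon n | p.2 = α ∧ weightLe w q p}.Finite := by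
    intro α
    -- For fixed `α`, the condition bounds the exponent of `t` by this quotient because `w.1 < 0`.
    obtain ⟨N, hN⟩ := exists_nat_gt ((wdeg w q - ∑ i, w.2 i * (α i : ℝ)) / w.1)
    refine ((Set.finite_Iio N).prod (Set.finite_singleton α)).subset ?_
    rintro ⟨b, a⟩ ⟨ha, h⟩
    obtain rfl : a = α := ha
    refine ⟨?_, rfl⟩
    have h1 : wdeg w q ≤ w.1 * (b : ℝ) + ∑ i, w.2 i * (a i : ℝ) := h
    have h2 : (b : ℝ) ≤ (wdeg w q - ∑ i, w.2 i * (a i : ℝ)) / w.1 := by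
      rw [le_div_iff_of_neg hw]
      linarith
    have h3 := h2.trans_lt hN
    exact_mod_cast h3
  refine ((finite_degree_le n D).biUnion fun α _ => hfin α).subset fun p hp => ?_
  exact Set.mem_biUnion hp.1 ⟨rfl, hp.2⟩

/-! ### Ideals are `t`-adically closed in bounded degree -/

theorem span_X_le_jacobson (R : Type*) [CommRing R] :
    Ideal.span {(PowerSeries.X : R⟦X⟧)} ≤ Ideal.jacobson ⊥ := by
  rw [Ideal.span_singleton_le_iff_mem, Ideal.mem_jacobson_bot]
  intro y
  rw [PowerSeries.isUnit_iff_constantCoeff]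
  simp

/-- Polynomials of `x`-degree at most `D` form a finite free `R⟦X⟧`-module. Its quotient by the part
lying in `I` is finitely generated over a noetherian ring with `X` in the Jacobson radical, so
Krull's theorem kills the class of `f`, which is divisible by every power of `X`. -/
theorem mem_of_forall_exists_congr [IsNoetherianRing R] {I : Ideal (MixedRing R n)}
    {f : MixedRing R n} {D : ℕ} (hf : ∀ q, tcoeff f q ≠ 0 → q.2.degree ≤ D)
    (h : ∀ N, ∃ g ∈ I, (∀ q, tcoeff g q ≠ 0 → q.2.degree ≤ D) ∧
      ∀ q : Mon n, q.1 < N → tcoeff g q = tcoeff f q) : f ∈ I := by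
  classical
  let A := (finite_degree_le n D).toFinset
  let Φ : (A → R⟦X⟧) →ₗ[R⟦X⟧] MixedRing R n :=
    Fintype.linearCombination R⟦X⟧ fun a : A => MvPolynomial.monomial a.1 1
  let restr : MixedRing R n → A → R⟦X⟧ := fun g a => MvPolynomial.coeff a.1 g
  have hΦ : ∀ g : MixedRing R n, (∀ q, tcoeff g q ≠ 0 → q.2.degree ≤ D) → Φ (restr g) = g := by
    intro g hg
    refine MvPolynomial.ext _ _ fun α => ?_
    have h1 : MvPolynomial.coeff α (Φ (restr g)) =
        ∑ a : A, if a.1 = α then MvPolynomial.coeff a.1 g else 0 := by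
      simp [Φ, restr, Fintype.linearCombination_apply, MvPolynomial.coeff_sum,
        MvPolynomial.coeff_monomial]
    rw [h1]
    by_cases hα : α ∈ A
    · rw [Finset.sum_eq_single (⟨α, hα⟩ : A)]
      · simp
      · intro b _ hb
        exact if_neg fun h => hb (Subtype.ext h)
      · simp
    · rw [Finset.sum_eq_zero]
      · symm
        refine PowerSeries.ext fun β => ?_
        by_contra hne
        exact hα (by simpa [A] using hg (β, α) hne)
      · intro b _
        exact if_neg fun h : b.1 = α => hα (h ▸ b.2)
  let N : Submodule R⟦X⟧ (A → R⟦X⟧) := (I.restrictScalars R⟦X⟧).comap Φ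
  have hmem : N.mkQ (restr f) ∈ (⊥ : Submodule R⟦X⟧ ((A → R⟦X⟧) ⧸ N)) := by
    rw [← Ideal.iInf_pow_smul_eq_bot_of_le_jacobson _ (span_X_le_jacobson R), Submodule.mem_iInf]
    intro k
    obtain ⟨g, hgI, hgD, hg⟩ := h k
    have hgN : N.mkQ (restr g) = 0 := by
      rw [Submodule.mkQ_apply, Submodule.Quotient.mk_eq_zero]
      change Φ (restr g) ∈ I
      rwa [hΦ g hgD]
    have hdvd : ∀ a : A, ∃ s : R⟦X⟧, restr f a - restr g a = PowerSeries.X ^ k * s := by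
      intro a
      refine PowerSeries.X_pow_dvd_iff.2 fun m hm => ?_
      have := hg (m, a.1) hm
      simp only [tcoeff] at this
      simp [restr, this]
    choose s hs using hdvd
    have hsub : restr f = (PowerSeries.X ^ k : R⟦X⟧) • s + restr g := by
      funext a
      simp [← hs a]
    rw [hsub, map_add, hgN, add_zero, map_smul, Ideal.span_singleton_pow]
    exact Submodule.smul_mem_smul (Ideal.mem_span_singleton_self _) trivial
  rw [Submodule.mem_bot, Submodule.mkQ_apply, Submodule.Quotient.mk_eq_zero] at hmem
  have hmem' : Φ (restr f) ∈ I := hmem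
  rwa [hΦ f hf] at hmem'

/-! ### Reduction -/

/-- The number of monomials of `x`-degree at most `D` that are greater than `q`. -/
def rank (le : Mon n → Mon n → Prop) (D : ℕ) (q : Mon n) : ℕ :=
  {p : Mon n | p.2.degree ≤ D ∧ le q p ∧ p ≠ q}.ncard

/-- Everything above `q` is above `p`, and so is `q` itself; finiteness makes the count strict. Rank
thus turns reduction from the top downwards into an induction over `ℕ`. -/
theorem rank_lt_rank {w : Weight n} (hw : w.1 < 0) {le : Mon n → Mon n → Prop}
    (hle : IsMonomialOrdering le) {D : ℕ} {p q : Mon n} (hq : q.2.degree ≤ D)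
    (h : weightedOrder w le p q) (hne : p ≠ q) :
    rank (weightedOrder w le) D q < rank (weightedOrder w le) D p := by
  have hV := isTermOrder_weightedOrder hw hle
  refine Set.ncard_lt_ncard ⟨?_, fun hsub => ?_⟩ ((finite_degree_le_of_weightLe hw D p).subset
    fun r hr => ⟨hr.1, weightLe_of_weightedOrder hr.2.1⟩)
  · rintro r ⟨h1, h2, h3⟩
    refine ⟨h1, hV.trans _ _ _ h h2, ?_⟩
    rintro rfl
    exact hne (hV.antisymm _ _ h h2)
  · exact (hsub ⟨hq, h, hne.symm⟩ : _ ∧ _ ∧ _).2.2 rfl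

/-- At most one monomial of degree at most `D` has rank `k`. If its term lies in `L`, a lift of that
term removes it, and the rest of the lift has larger rank, so what was settled at smaller ranks is
not disturbed. -/
theorem exists_reduction_at_rank {v : Weight n} (hv : v.1 < 0) {le : Mon n → Mon n → Prop}
    (hle : IsMonomialOrdering le) {I : Ideal (MixedRing R n)} (hI : IsXHomogeneous I)
    {L : Ideal (PolyRing R n)} (hL : L ≤ leadIdeal (weightedOrder v le) (I : Set (MixedRing R n)))
    (m : Mon n) (D k : ℕ) (f : MixedRing R n) :
    ∃ h ∈ I, (∀ q, tcoeff h q ≠ 0 → q.2.degree ≤ D ∧ weightedOrder v le q m ∧ q ≠ m ∧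
        k ≤ rank (weightedOrder v le) D q) ∧
      ∀ q : Mon n, q.2.degree ≤ D → rank (weightedOrder v le) D q = k →
        weightedOrder v le q m → q ≠ m → tcoeff (f - h) q ≠ 0 →
        term q (tcoeff (f - h) q) ∉ L := by
  have hV := isTermOrder_weightedOrder hv hle
  by_cases hex : ∃ q : Mon n, q.2.degree ≤ D ∧ rank (weightedOrder v le) D q = k ∧
      weightedOrder v le q m ∧ q ≠ m ∧ term q (tcoeff f q) ∈ L
  · obtain ⟨q₀, hE, hk, hm, hne, hq₀⟩ := hex
    obtain ⟨h, hhI, hc, hh⟩ := exists_homogeneous_lift hV.toIsTermPreorder hI (hL hq₀)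
    refine ⟨h, hhI, fun q hq => ?_, fun q hqE hqk _ _ hne' => ?_⟩
    · obtain ⟨h1, h2⟩ := hh q hq
      refine ⟨h2 ▸ hE, hV.trans _ _ _ h1 hm, ?_, ?_⟩
      · rintro rfl
        exact hne (hV.antisymm _ _ hm h1)
      · rcases eq_or_ne q q₀ with rfl | hqq
        · exact hk.ge
        · exact hk ▸ (rank_lt_rank hv hle hE h1 hqq).le
    · have : q = q₀ := by
        by_contra hqq
        rcases hV.total q q₀ with h1 | h1
        · have := rank_lt_rank hv hle hE h1 hqq
          omega
        · have := rank_lt_rank hv hle hqE h1 (Ne.symm hqq)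
          omega
      subst this
      exact absurd (by simp [hc]) hne'
  · refine ⟨0, I.zero_mem, by simp, fun q hE hk hm hne _ hmem => hex ⟨q, hE, hk, hm, hne, ?_⟩⟩
    simpa using hmem

/-- Reduction of the terms of `f` below the monomial `m` by elements of `I`. -/
theorem exists_reduction [IsNoetherianRing R] {v : Weight n} (hv : v.1 < 0)
    {le : Mon n → Mon n → Prop} (hle : IsMonomialOrdering le) {I : Ideal (MixedRing R n)}
    (hI : IsXHomogeneous I) {L : Ideal (PolyRing R n)}
    (hL : L ≤ leadIdeal (weightedOrder v le) (I : Set (MixedRing R n)))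
    (f : MixedRing R n) (m : Mon n) :
    ∃ h ∈ I, (∀ q, tcoeff h q ≠ 0 → weightedOrder v le q m ∧ q ≠ m) ∧
      ∀ q, weightedOrder v le q m → q ≠ m → tcoeff (f - h) q ≠ 0 →
        term q (tcoeff (f - h) q) ∉ L := by
  obtain ⟨D, hD⟩ := exists_degree_bound f
  choose H hHI hHsupp hHred using exists_reduction_at_rank hv hle hI hL m D
  generalize rank (weightedOrder v le) D = rk at hHsupp hHred
  obtain ⟨F, hFzero, hFsucc⟩ :
      ∃ F : ℕ → MixedRing R n, F 0 = f ∧ ∀ k, F (k + 1) = F k - H k (F k) :=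
    ⟨fun k => Nat.rec f (fun k g => g - H k g) k, rfl, fun k => rfl⟩
  have hFI : ∀ k, f - F k ∈ I := by
    intro k
    induction k with
    | zero => simp [hFzero]
    | succ k ih =>
      have : f - F (k + 1) = (f - F k) + H k (F k) := by rw [hFsucc]; ring
      rw [this]
      exact I.add_mem ih (hHI _ _)
  have hFsupp : ∀ k q, tcoeff (f - F k) q ≠ 0 →
      q.2.degree ≤ D ∧ weightedOrder v le q m ∧ q ≠ m := by
    intro k
    induction k with
    | zero => simp [hFzero]
    | succ k ih =>
      intro q hq
      have : f - F (k + 1) = (f - F k) + H k (F k) := by rw [hFsucc]; ring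
      rw [this, tcoeff_add] at hq
      by_cases h0 : tcoeff (f - F k) q = 0
      · obtain ⟨h1, h2, h3, -⟩ := hHsupp k (F k) q fun h => hq (by rw [h0, h, add_zero])
        exact ⟨h1, h2, h3⟩
      · exact ih q h0
  -- Stage `k` alters only monomials of rank at least `k`, so the coefficient at `q` is final after
  -- stage `rk q`.
  have hstable : ∀ q k, rk q + 1 ≤ k → tcoeff (F k) q = tcoeff (F (rk q + 1)) q := by
    intro q k hk
    induction k, hk using Nat.le_induction with
    | base => rfl
    | succ k hk ih =>
      rw [hFsucc, tcoeff_sub, ih]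
      by_cases h0 : tcoeff (H k (F k)) q = 0
      · rw [h0, sub_zero]
      · have : k ≤ rk q := (hHsupp k (F k) q h0).2.2.2
        omega
  -- The limit of the `f - F k`, assembled from the final coefficients.
  obtain ⟨h, hh⟩ : ∃ h : MixedRing R n, h = ∑ α ∈ (finite_degree_le n D).toFinset,
    MvPolynomial.monomial α
      (PowerSeries.mk fun β => tcoeff (f - F (rk (β, α) + 1)) (β, α)) := ⟨_, rfl⟩
  have hcoeff : ∀ q, tcoeff h q = tcoeff (f - F (rk q + 1)) q := by
    classical
    rintro ⟨β, α⟩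
    have h1 : MvPolynomial.coeff α h = if α.degree ≤ D then
        PowerSeries.mk fun β => tcoeff (f - F (rk (β, α) + 1)) (β, α) else 0 := by
      simp [hh, MvPolynomial.coeff_sum, MvPolynomial.coeff_monomial]
    change PowerSeries.coeff β (MvPolynomial.coeff α h) = _
    rw [h1]
    split_ifs with hα
    · simp
    · by_contra hne
      exact hα (hFsupp (rk (β, α) + 1) (β, α) fun h0 => hne (by rw [h0, map_zero])).1
  refine ⟨h, ?_, fun q hq => ?_, fun q hqm hne hq => ?_⟩
  · refine mem_of_forall_exists_congr (D := D) (fun q hq => (hFsupp _ q (by rwa [hcoeff] at hq)).1)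
      fun N => ?_
    -- Only finitely many monomials have `x`-degree at most `D` and `t`-exponent below `N`; at stage
    -- `K` all of them are settled.
    let K := (finite_degree_le_of_lt n D N).toFinset.sup rk + 1
    refine ⟨f - F K, hFI K, fun q hq => (hFsupp K q hq).1, fun q hq => ?_⟩
    rw [hcoeff]
    by_cases hE : q.2.degree ≤ D
    · have : rk q ≤ (finite_degree_le_of_lt n D N).toFinset.sup rk :=
        Finset.le_sup (by simpa using ⟨hE, hq⟩)
      rw [tcoeff_sub, tcoeff_sub, hstable q K (by omega)]
    · have h0 : ∀ k, tcoeff (f - F k) q = 0 := fun k => by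
        by_contra h0
        exact hE (hFsupp k q h0).1
      rw [h0, h0]
  · exact (hFsupp _ q (by rwa [hcoeff] at hq)).2
  · have heq : tcoeff (f - h) q = tcoeff (F (rk q) - H (rk q) (F (rk q))) q := by
      rw [tcoeff_sub, hcoeff, tcoeff_sub, ← hFsucc]
      ring
    have hE : q.2.degree ≤ D := by
      by_contra hE
      have h0 : tcoeff (f - F (rk q + 1)) q = 0 := by
        by_contra h0
        exact hE (hFsupp _ q h0).1
      have h1 : tcoeff f q = 0 := by
        by_contra h1
        exact hE (hD q h1)
      rw [tcoeff_sub, hcoeff, h0, h1, sub_zero] at hq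
      exact hq rfl
    rw [heq] at hq ⊢
    exact hHred (rk q) (F (rk q)) q hE rfl hqm hne hq

/-! ### Initially reduced standard bases -/

/-- A homogeneous component of `g` of another degree would lie in `I`, and its leading term would be
a non-leading term of `g` with exponent in `minExps g` lying in `lt(I)`. -/
theorem degree_eq_of_initiallyReduced {le : Mon n → Mon n → Prop} (hle : IsTermOrder le)
    {I : Ideal (MixedRing R n)} (hI : IsXHomogeneous I) {g : MixedRing R n} (hg : g ∈ I)
    (hred : ∀ p ∈ minExps g, p ∉ topExps le g →
      term p (tcoeff g p) ∉ leadIdeal le (I : Set (MixedRing R n)))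
    {m : Mon n} (hm : m ∈ topExps le g) {q : Mon n} (hq : tcoeff g q ≠ 0) :
    q.2.degree = m.2.degree := by
  by_contra hne
  have hcoeff := tcoeff_homogeneousComponent g q.2.degree
  have hI' := hI.homogeneousComponent_mem hg q.2.degree
  generalize MvPolynomial.homogeneousComponent q.2.degree g = g' at hcoeff hI'
  have hg' : g' ≠ 0 := by
    rintro rfl
    exact hq (by simpa using (hcoeff q).symm)
  obtain ⟨m', hm'⟩ := hle.topExps_nonempty hg'
  have hmin := (mem_minExps _ _).1 (topExps_subset_minExps _ _ hm')
  have hdeg : m'.2.degree = q.2.degree := by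
    by_contra h
    exact hmin.1 (by rw [hcoeff, if_neg h])
  have heq : ∀ b, tcoeff g' (b, m'.2) = tcoeff g (b, m'.2) := fun b => by
    rw [hcoeff, if_pos hdeg]
  have heq' : tcoeff g' m' = tcoeff g m' := heq m'.1
  refine hred m' ((mem_minExps _ _).2 ⟨heq' ▸ hmin.1, fun b hb => heq b ▸ hmin.2 b hb⟩) ?_ ?_
  · rw [hle.topExps_eq_singleton hm, Finset.mem_singleton]
    rintro rfl
    exact hne hdeg.symm
  · rw [← heq']
    exact hle.term_mem_leadIdeal hI' hm'

/-- Reduction below the leading monomial modulo all of `lt(I)` leaves the leading term intact and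
removes every other term lying in `lt(I)`. -/
theorem exists_reduced_of_leadTerm_ne_zero [IsNoetherianRing R] {w : Weight n} (hw : w.1 < 0)
    {le : Mon n → Mon n → Prop} (hle : IsMonomialOrdering le) {I : Ideal (MixedRing R n)}
    (hI : IsXHomogeneous I) {f : MixedRing R n} (hf : f ∈ I)
    (hne : leadTerm (weightedOrder w le) f ≠ 0) :
    ∃ g ∈ I, leadTerm (weightedOrder w le) g = leadTerm (weightedOrder w le) f ∧
      ∀ p ∈ minExps g, p ∉ topExps (weightedOrder w le) g →
        term p (tcoeff g p) ∉ leadIdeal (weightedOrder w le) (I : Set (MixedRing R n)) := by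
  have hW := isTermOrder_weightedOrder hw hle
  have hf0 : f ≠ 0 := by
    rintro rfl
    refine hne (pcoeff_ext fun q => ?_)
    rw [leadTerm, pcoeff_topForm]
    simp
  obtain ⟨m, hm⟩ := hW.topExps_nonempty hf0
  obtain ⟨h, hhI, hhm, hred⟩ := exists_reduction hw hle hI le_rfl f m
  have hhm0 : tcoeff h m = 0 := by
    by_contra h0
    exact (hhm m h0).2 rfl
  have hm' := hW.mem_topExps.1 hm
  have hgm : m ∈ topExps (weightedOrder w le) (f - h) := by
    refine hW.mem_topExps.2 ⟨by simpa [hhm0] using hm'.1, fun q hq => ?_⟩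
    by_cases h0 : tcoeff h q = 0
    · exact hm'.2 q (by simpa [h0] using hq)
    · exact (hhm q h0).1
  refine ⟨f - h, I.sub_mem hf hhI, ?_, fun p hp hpt => ?_⟩
  · rw [hW.leadTerm_eq hgm, hW.leadTerm_eq hm, tcoeff_sub, hhm0, sub_zero]
  · have hp' := ((mem_minExps _ _).1 hp).1
    refine hred p ((hW.mem_topExps.1 hgm).2 p hp') ?_ hp'
    rintro rfl
    exact hpt hgm

theorem exists_isInitiallyReducedStandardBasis [IsNoetherianRing R] {w : Weight n} (hw : w.1 < 0)
    {le : Mon n → Mon n → Prop} (hle : IsMonomialOrdering le) {I : Ideal (MixedRing R n)}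
    (hI : IsXHomogeneous I) :
    ∃ G : Finset (MixedRing R n), IsInitiallyReducedStandardBasis (weightedOrder w le) I G := by
  classical
  set W := weightedOrder w le with hWdef
  -- A generating set of leading terms of least cardinality is minimal under inclusion, and in
  -- particular avoids `0`.
  have hex : ∃ k, ∃ T : Finset (PolyRing R n), T.card = k ∧
      (T : Set (PolyRing R n)) ⊆ leadTerm W '' (I : Set (MixedRing R n)) ∧
      Ideal.span (T : Set (PolyRing R n)) = leadIdeal W (I : Set (MixedRing R n)) := by
    obtain ⟨T, hT, hspan⟩ := (Submodule.fg_span_iff_fg_span_finset_subset _).1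
      (IsNoetherian.noetherian (leadIdeal W (I : Set (MixedRing R n))))
    exact ⟨T.card, T, rfl, hT, hspan.symm⟩
  obtain ⟨T, hcard, hTI, hspan⟩ := Nat.find_spec hex
  have hmin : ∀ S : Finset (PolyRing R n), S ⊂ T →
      Ideal.span (S : Set (PolyRing R n)) ≠ leadIdeal W (I : Set (MixedRing R n)) := by
    intro S hS hSspan
    refine Nat.find_min hex (hcard ▸ Finset.card_lt_card hS) ⟨S, rfl, ?_, hSspan⟩
    exact (Finset.coe_subset.2 hS.subset).trans hTI
  have hzero : (0 : PolyRing R n) ∉ T := by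
    intro h0
    refine hmin (T.erase 0) (Finset.erase_ssubset h0) ?_
    rw [Finset.coe_erase, Ideal.span_sdiff_singleton_zero, hspan]
  have hg : ∀ τ : T, ∃ g ∈ I, leadTerm W g = τ ∧
      ∀ p ∈ minExps g, p ∉ topExps W g →
        term p (tcoeff g p) ∉ leadIdeal W (I : Set (MixedRing R n)) := by
    rintro ⟨τ, hτ⟩
    obtain ⟨f, hf, hfτ⟩ := hTI hτ
    obtain ⟨g, hg, hlt, hred⟩ := exists_reduced_of_leadTerm_ne_zero hw hle hI hf
      (fun h => hzero (by rw [← h]; exact hfτ ▸ hτ))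
    exact ⟨g, hg, hlt.trans hfτ, hred⟩
  choose g hgI hglt hgred using hg
  have himage : leadTerm W '' (Finset.univ.image g : Set (MixedRing R n)) = T := by
    ext τ
    simp only [Finset.coe_image, Finset.coe_univ, Set.image_univ, Set.mem_image, Set.mem_range,
      exists_exists_eq_and, hglt]
    simp
  have hlead : leadIdeal W (Finset.univ.image g : Set (MixedRing R n)) =
      leadIdeal W (I : Set (MixedRing R n)) := by
    rw [leadIdeal, himage, hspan]
  refine ⟨Finset.univ.image g, ⟨?_, ?_⟩, ?_, ?_⟩
  · intro x hx
    obtain ⟨τ, -, rfl⟩ := Finset.mem_image.1 hx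
    exact hgI τ
  · exact hlead
  · intro S hS
    rw [himage] at hS
    have hfin : S.Finite := T.finite_toSet.subset hS.subset
    have := hmin hfin.toFinset (by rwa [← Finset.coe_ssubset, hfin.coe_toFinset])
    rwa [hfin.coe_toFinset] at this
  · intro x hx
    obtain ⟨τ, -, rfl⟩ := Finset.mem_image.1 hx
    rw [hlead]
    exact hgred τ

/-! ### Initial ideals and standard bases -/

theorem mem_topExps_weightedOrder {v : Weight n} (hv : v.1 < 0) {le : Mon n → Mon n → Prop}
    (hle : IsMonomialOrdering le) {f : MixedRing R n} {m : Mon n} :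
    m ∈ topExps (weightedOrder v le) f ↔
      m ∈ topExps (weightLe v) f ∧ ∀ q ∈ topExps (weightLe v) f, le q m := by
  rw [(isTermPreorder_weightedOrder hv hle).mem_topExps]
  simp only [(isTermPreorder_weightLe hv).mem_topExps]
  constructor
  · rintro ⟨h1, h2⟩
    refine ⟨⟨h1, fun q hq => weightLe_of_weightedOrder (h2 q hq)⟩, fun q ⟨hq, hmax⟩ => ?_⟩
    rcases h2 q hq with h | h
    · exact absurd (hmax m h1) (not_le.2 h)
    · exact h.2
  · rintro ⟨⟨h1, h2⟩, h3⟩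
    refine ⟨h1, fun q hq => ?_⟩
    rcases (h2 q hq).lt_or_eq with h | h
    · exact Or.inl h
    · exact Or.inr ⟨h, h3 q ⟨hq, fun q' hq' => (h2 q' hq').trans h.ge⟩⟩

theorem wdeg_eq_of_mem_topExps {v : Weight n} (hv : v.1 < 0) {f : MixedRing R n} {p q : Mon n}
    (hp : p ∈ topExps (weightLe v) f) (hq : q ∈ topExps (weightLe v) f) : wdeg v p = wdeg v q := by
  rw [(isTermPreorder_weightLe hv).mem_topExps] at hp hq
  exact le_antisymm (hq.2 p hp.1) (hp.2 q hq.1)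

/-- The part of `p` of the `v`-degree of `m` is the initial form of some `f ∈ I`, and the
`le`-greatest monomial of that part is the `>_v`-leading monomial of `f`. -/
theorem term_mem_leadIdeal_of_mem_initialIdeal {v : Weight n} (hv : v.1 < 0)
    {le : Mon n → Mon n → Prop} (hle : IsMonomialOrdering le) {I : Ideal (MixedRing R n)}
    {p : PolyRing R n} (hp : p ∈ initialIdeal v I) {m : Mon n} (hm : pcoeff p m ≠ 0)
    (hmax : ∀ q, pcoeff p q ≠ 0 → wdeg v q = wdeg v m → le q m) :
    term m (pcoeff p m) ∈ leadIdeal (weightedOrder v le) (I : Set (MixedRing R n)) := by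
  have hv' := isTermPreorder_weightLe hv
  obtain ⟨f, hf, hfm, hfp⟩ := exists_mem_of_mem_span_topForm hv' hp m
  have hcm := hfp m (hv'.refl m) (hv'.refl m)
  have htop : m ∈ topExps (weightedOrder v le) f := by
    have hm' : m ∈ topExps (weightLe v) f := hv'.mem_topExps.2 ⟨hcm ▸ hm, hfm⟩
    refine (mem_topExps_weightedOrder hv hle).2 ⟨hm', fun q hq => ?_⟩
    have hqm := wdeg_eq_of_mem_topExps hv hq hm'
    refine hmax q ?_ hqm
    rw [← hfp q hqm.le hqm.ge]
    exact (hv'.mem_topExps.1 hq).1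
  rw [← hcm]
  exact (isTermOrder_weightedOrder hv hle).term_mem_leadIdeal hf htop

/-- The leading terms of `G` lift to the ideal generated by the initial forms of `G`. -/
theorem exists_mem_span_initialForm {v : Weight n} (hv : v.1 < 0)
    {le : Mon n → Mon n → Prop} (hle : IsMonomialOrdering le) {G : Set (MixedRing R n)}
    (hdeg : ∀ g ∈ G, ∀ p q, tcoeff g p ≠ 0 → tcoeff g q ≠ 0 → p.2.degree = q.2.degree)
    {p : PolyRing R n} (hp : p ∈ leadIdeal (weightedOrder v le) G) (q₀ : Mon n) :
    ∃ k ∈ Ideal.span (initialForm v '' G), pcoeff k q₀ = pcoeff p q₀ ∧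
      ∀ q, pcoeff k q ≠ 0 → wdeg v q = wdeg v q₀ ∧ weightedOrder v le q q₀ ∧
        q.2.degree = q₀.2.degree := by
  classical
  have hv' := isTermPreorder_weightLe hv
  have hV := isTermOrder_weightedOrder hv hle
  obtain ⟨F, ⟨k, hk, rfl, hkq⟩, h⟩ := exists_lift_of_mem_span hV.toIsTermPreorder
    (fun q₀ F => ∃ k ∈ Ideal.span (initialForm v '' G), pcoeff k = F ∧
      ∀ q, F q ≠ 0 → wdeg v q = wdeg v q₀ ∧ weightedOrder v le q q₀ ∧ q.2.degree = q₀.2.degree)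
    (fun q => ⟨0, Ideal.zero_mem _, by funext q; simp, by simp⟩)
    (by
      rintro q _ _ ⟨f, hf, rfl, h⟩ ⟨f', hf', rfl, h'⟩
      refine ⟨f + f', Ideal.add_mem _ hf hf', by funext q; simp, fun q' hq' => ?_⟩
      by_cases h0 : pcoeff f q' = 0
      · exact h' q' fun h0' => hq' (by simp [h0, h0'])
      · exact h q' h0)
    (by
      rintro q u c _ ⟨f, hf, rfl, h⟩
      refine ⟨term u c * f, Ideal.mul_mem_left _ _ hf, pcoeff_term_mul u c f, fun q' hq' => ?_⟩
      obtain ⟨q'', rfl, hq''⟩ := shift_ne_zero hq'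
      obtain ⟨h1, h2, h3⟩ := h q'' hq''
      exact ⟨by rw [wdeg_add, wdeg_add, h1], (hV.add_iff _ _ _).2 h2, by simp [h3]⟩)
    (by
      rintro q q' _ h h' hP
      rwa [← hV.antisymm _ _ h h'])
    (by
      rintro _ ⟨g, hg, rfl⟩ q₀
      by_cases htop : q₀ ∈ topExps (weightedOrder v le) g
      · have hq₀ := ((mem_topExps_weightedOrder hv hle).1 htop).1
        have htop' := hV.mem_topExps.1 htop
        refine ⟨_, ⟨_, Ideal.subset_span ⟨g, hg, rfl⟩, rfl, fun q hq => ?_⟩, fun q h h' => ?_⟩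
        · rw [initialForm, pcoeff_topForm] at hq
          split_ifs at hq with hq'
          · exact ⟨wdeg_eq_of_mem_topExps hv hq' hq₀, htop'.2 q hq, hdeg g hg _ _ hq htop'.1⟩
          · exact absurd rfl hq
        · obtain rfl := hV.antisymm _ _ h h'
          rw [initialForm, leadTerm, pcoeff_topForm, pcoeff_topForm, if_pos htop, if_pos hq₀]
      · refine ⟨0, ⟨0, Ideal.zero_mem _, by funext q; simp, by simp⟩, fun q h h' => ?_⟩
        obtain rfl := hV.antisymm _ _ h h'
        rw [leadTerm, pcoeff_topForm, if_neg htop]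
        rfl)
    hp q₀
  exact ⟨k, hk, h q₀ (hV.refl _) (hV.refl _), hkq⟩

/-- The initial forms of an `x`-homogeneous standard basis generate the initial ideal. -/
theorem initialIdeal_eq_span {v : Weight n} (hv : v.1 < 0)
    {le : Mon n → Mon n → Prop} (hle : IsMonomialOrdering le) {I : Ideal (MixedRing R n)}
    {G : Set (MixedRing R n)} (hGI : G ⊆ I)
    (hG : leadIdeal (weightedOrder v le) G = leadIdeal (weightedOrder v le) I)
    (hdeg : ∀ g ∈ G, ∀ p q, tcoeff g p ≠ 0 → tcoeff g q ≠ 0 → p.2.degree = q.2.degree) :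
    initialIdeal v I = Ideal.span (initialForm v '' G) := by
  classical
  have hV := isTermOrder_weightedOrder hv hle
  have hKJ : Ideal.span (initialForm v '' G) ≤ initialIdeal v I :=
    Ideal.span_mono (Set.image_mono hGI)
  refine le_antisymm (Ideal.span_le.2 ?_) hKJ
  -- Within fixed weight and bounded degree, the finite set `A` contains every monomial at or below
  -- the support of `p`. Cancelling the leading term `m` by an element of the span with the same
  -- weight and degree allows `m` to be dropped from `A`.
  have key : ∀ (c : ℝ) (D : ℕ) (A : Finset (Mon n)), ∀ p ∈ initialIdeal v I,
      (∀ q, pcoeff p q ≠ 0 → wdeg v q = c ∧ q.2.degree ≤ D) →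
      (∀ q q' : Mon n, wdeg v q = c → q.2.degree ≤ D → pcoeff p q' ≠ 0 →
        weightedOrder v le q q' → q ∈ A) → p ∈ Ideal.span (initialForm v '' G) := by
    intro c D A
    induction A using Finset.strongInduction with
    | H A ih =>
      intro p hp hpc hpA
      by_cases hp0 : p = 0
      · exact hp0 ▸ Ideal.zero_mem _
      obtain ⟨q₁, hq₁⟩ := exists_pcoeff_ne_zero hp0
      obtain ⟨m, hm, hmax⟩ := hV.exists_greatest (finite_pcoeff_support p).toFinset
        ⟨q₁, by simpa using hq₁⟩
      have hm : pcoeff p m ≠ 0 := by simpa using hm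
      have hmax : ∀ q, pcoeff p q ≠ 0 → weightedOrder v le q m :=
        fun q hq => hmax q (by simpa using hq)
      have hterm := term_mem_leadIdeal_of_mem_initialIdeal hv hle hp hm fun q hq hqm => by
        rcases hmax q hq with h | h
        · exact absurd hqm h.ne
        · exact h.2
      rw [← hG] at hterm
      obtain ⟨k, hk, hkm, hkq⟩ := exists_mem_span_initialForm hv hle hdeg hterm m
      rw [pcoeff_term, if_pos rfl] at hkm
      have hmA : m ∈ A := hpA m m (hpc m hm).1 (hpc m hm).2 hm (hV.refl m)
      have hsupp : ∀ q, pcoeff (p - k) q ≠ 0 →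
          (wdeg v q = c ∧ q.2.degree ≤ D) ∧ weightedOrder v le q m ∧ q ≠ m := by
        intro q hq
        have hqm : q ≠ m := by
          rintro rfl
          exact hq (by simp [hkm])
        by_cases h0 : pcoeff p q = 0
        · obtain ⟨h1, h2, h3⟩ := hkq q fun h => hq (by simp [h0, h])
          exact ⟨⟨h1.trans (hpc m hm).1, h3 ▸ (hpc m hm).2⟩, h2, hqm⟩
        · exact ⟨hpc q h0, hmax q h0, hqm⟩
      have hpk := ih (A.erase m) (Finset.erase_ssubset hmA) (p - k)
        (Ideal.sub_mem _ hp (hKJ hk)) (fun q hq => (hsupp q hq).1) fun q q' hqc hqD hq' hle' => by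
          obtain ⟨-, h2, h3⟩ := hsupp q' hq'
          refine Finset.mem_erase.2 ⟨?_, hpA q m hqc hqD hm (hV.trans _ _ _ hle' h2)⟩
          rintro rfl
          exact h3 (hV.antisymm _ _ h2 hle')
      simpa using Ideal.add_mem _ hpk hk
  rintro _ ⟨f, hf, rfl⟩
  by_cases hf0 : f = 0
  · have : initialForm v f = 0 := pcoeff_ext fun q => by
      rw [initialForm, pcoeff_topForm]
      simp [hf0]
    rw [this]
    exact Ideal.zero_mem _
  obtain ⟨m, hm⟩ := (isTermPreorder_weightLe hv).topExps_nonempty hf0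
  obtain ⟨D, hD⟩ := exists_degree_bound f
  refine key (wdeg v m) D (finite_degree_le_of_weightLe hv D m).toFinset _
    (Ideal.subset_span ⟨f, hf, rfl⟩) (fun q hq => ?_) fun q q' hqc hqD _ _ => ?_
  · rw [initialForm, pcoeff_topForm] at hq
    split_ifs at hq with hq'
    · exact ⟨wdeg_eq_of_mem_topExps hv hq' hm, hD q hq⟩
    · exact absurd rfl hq
  · simpa using ⟨hqD, hqc.ge⟩

/-- If the initial forms of the standard basis `G` for `w` do not change when passing to `v`, then
`G` is a standard basis for `v` as well. -/
theorem leadIdeal_eq_of_topExps_eq [IsNoetherianRing R] {v w : Weight n} (hv : v.1 < 0)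
    (hw : w.1 < 0) {le : Mon n → Mon n → Prop} (hle : IsMonomialOrdering le)
    {I : Ideal (MixedRing R n)} (hI : IsXHomogeneous I) {G : Set (MixedRing R n)} (hGI : G ⊆ I)
    (hG : leadIdeal (weightedOrder w le) G = leadIdeal (weightedOrder w le) I)
    (htop : ∀ g ∈ G, topExps (weightLe v) g = topExps (weightLe w) g) :
    leadIdeal (weightedOrder v le) G = leadIdeal (weightedOrder v le) I := by
  have hV := isTermOrder_weightedOrder hv hle
  have hW := isTermOrder_weightedOrder hw hle
  have hle_lead : leadIdeal (weightedOrder v le) G ≤ leadIdeal (weightedOrder v le) I :=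
    Ideal.span_mono (Set.image_mono hGI)
  have hGvw : leadIdeal (weightedOrder v le) G = leadIdeal (weightedOrder w le) G := by
    refine congrArg Ideal.span (Set.image_congr fun g hg => ?_)
    have : topExps (weightedOrder v le) g = topExps (weightedOrder w le) g := by
      ext m
      rw [mem_topExps_weightedOrder hv hle, mem_topExps_weightedOrder hw hle, htop g hg]
    rw [leadTerm, leadTerm, topForm, topForm, this]
  refine le_antisymm hle_lead (Ideal.span_le.2 ?_)
  rintro _ ⟨f, hf, rfl⟩
  by_contra hnot
  have hf0 : f ≠ 0 := by
    rintro rfl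
    refine hnot ?_
    have : leadTerm (weightedOrder v le) (0 : MixedRing R n) = 0 := pcoeff_ext fun q => by
      rw [leadTerm, pcoeff_topForm]
      simp
    rw [this]
    exact Ideal.zero_mem _
  obtain ⟨m, hm⟩ := hV.topExps_nonempty hf0
  rw [hV.leadTerm_eq hm] at hnot
  obtain ⟨h, hhI, hhm, hred⟩ := exists_reduction hv hle hI hle_lead f m
  have hm' := hV.mem_topExps.1 hm
  have hhm0 : tcoeff h m = 0 := by
    by_contra h0
    exact (hhm m h0).2 rfl
  have hfhm : tcoeff (f - h) m = tcoeff f m := by simp [hhm0]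
  have hfh : f - h ≠ 0 := fun h0 => hm'.1 (by rw [← hfhm, h0, tcoeff_zero])
  -- The `>_w`-leading term of `f - h` lies in `lt_w(I) = lt_v(G)`. But no term of `f - h` does: not
  -- below `m` by reduction, and not at `m` by assumption.
  obtain ⟨q, hq⟩ := hW.topExps_nonempty hfh
  have hmem := hW.term_mem_leadIdeal (H := (I : Set (MixedRing R n))) (I.sub_mem hf hhI) hq
  rw [← hG, ← hGvw] at hmem
  have hq0 := (hW.mem_topExps.1 hq).1
  rcases eq_or_ne q m with rfl | hqm
  · exact hnot (hfhm ▸ hmem)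
  · refine hred q ?_ hqm hq0 hmem
    by_cases h0 : tcoeff h q = 0
    · exact hm'.2 q (by simpa [h0] using hq0)
    · exact (hhm q h0).1

/-- Reducedness is used twice: to show that `g` has the same leading monomial for `>_v` and `>_w`,
then to exclude any other difference between the initial forms. -/
theorem topExps_eq_of_initialIdeal_eq {v w : Weight n} (hv : v.1 < 0)
    (hw : w.1 < 0) {le : Mon n → Mon n → Prop} (hle : IsMonomialOrdering le)
    {I : Ideal (MixedRing R n)} {g : MixedRing R n} (hg : g ∈ I)
    (hred : ∀ p ∈ minExps g, p ∉ topExps (weightedOrder w le) g →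
      term p (tcoeff g p) ∉ leadIdeal (weightedOrder w le) (I : Set (MixedRing R n)))
    (heq : initialIdeal v I = initialIdeal w I) :
    topExps (weightLe v) g = topExps (weightLe w) g := by
  classical
  have hV := isTermOrder_weightedOrder hv hle
  have hW := isTermOrder_weightedOrder hw hle
  by_cases hg0 : g = 0
  · ext m
    rw [(isTermPreorder_weightLe hv).mem_topExps, (isTermPreorder_weightLe hw).mem_topExps]
    simp [hg0]
  have hgv : initialForm v g ∈ initialIdeal w I :=
    heq ▸ Ideal.subset_span ⟨g, hg, rfl⟩
  have hgw : initialForm w g ∈ initialIdeal w I := Ideal.subset_span ⟨g, hg, rfl⟩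
  obtain ⟨m, hm⟩ := hV.topExps_nonempty hg0
  obtain ⟨hmv, hmax⟩ := (mem_topExps_weightedOrder hv hle).1 hm
  have hm0 := (hV.mem_topExps.1 hm).1
  have hcm : pcoeff (initialForm v g) m = tcoeff g m := by
    rw [initialForm, pcoeff_topForm, if_pos hmv]
  have hmW : m ∈ topExps (weightedOrder w le) g := by
    by_contra hmW
    refine hred m (topExps_subset_minExps _ _ hm) hmW ?_
    rw [← hcm]
    refine term_mem_leadIdeal_of_mem_initialIdeal hw hle hgv (hcm ▸ hm0) fun q hq _ => hmax q ?_
    by_contra hq'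
    exact hq (by rw [initialForm, pcoeff_topForm, if_neg hq'])
  have hmw := ((mem_topExps_weightedOrder hw hle).1 hmW).1
  by_contra hne
  have hd : ∀ q, pcoeff (initialForm v g - initialForm w g) q =
      (if q ∈ topExps (weightLe v) g then tcoeff g q else 0) -
        (if q ∈ topExps (weightLe w) g then tcoeff g q else 0) := fun q => by
    rw [pcoeff_sub, initialForm, initialForm, pcoeff_topForm, pcoeff_topForm]
  -- On the symmetric difference the coefficients of `in_v(g) - in_w(g)` are those of `g` up to
  -- sign; elsewhere they vanish. The greatest such `q` is not `m`, which lies in both sets.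
  obtain ⟨q, hq, hqmax⟩ := hW.exists_greatest
    (symmDiff (topExps (weightLe v) g) (topExps (weightLe w) g)) (by
      rw [Finset.nonempty_iff_ne_empty]
      exact fun h => hne (symmDiff_eq_bot.1 h))
  have hqmin : q ∈ minExps g := by
    rcases Finset.mem_symmDiff.1 hq with h | h
    · exact topExps_subset_minExps _ _ h.1
    · exact topExps_subset_minExps _ _ h.1
  have hq0 : tcoeff g q ≠ 0 := ((mem_minExps _ _).1 hqmin).1
  have hqm : q ∉ topExps (weightedOrder w le) g := by
    rw [hW.topExps_eq_singleton hmW, Finset.mem_singleton]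
    rintro rfl
    simp [Finset.mem_symmDiff, hmv, hmw] at hq
  have hdq : pcoeff (initialForm v g - initialForm w g) q = tcoeff g q ∨
      pcoeff (initialForm v g - initialForm w g) q = -tcoeff g q := by
    rw [hd]
    rcases Finset.mem_symmDiff.1 hq with h | h
    · left
      simp [h]
    · right
      simp [h]
  have hmem := term_mem_leadIdeal_of_mem_initialIdeal hw hle (Ideal.sub_mem _ hgv hgw)
    (m := q) (by rcases hdq with h | h <;> simpa [h] using hq0) fun p hp hpq => by
      have hp' : p ∈ symmDiff (topExps (weightLe v) g) (topExps (weightLe w) g) := by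
        rw [hd] at hp
        rw [Finset.mem_symmDiff]
        by_contra hcon
        by_cases h1 : p ∈ topExps (weightLe v) g <;> by_cases h2 : p ∈ topExps (weightLe w) g <;>
          simp [h1, h2] at hp hcon
      rcases hqmax p hp' with h | h
      · exact absurd hpq h.ne
      · exact h.2
  refine hred q hqmin hqm ?_
  rcases hdq with h | h
  · rwa [h] at hmem
  · rw [h] at hmem
    have : term q (-tcoeff g q) = -term q (tcoeff g q) := by simp [term]
    rwa [this, neg_mem_iff] at hmem

theorem initialIdeal_eq_iff [IsNoetherianRing R] {v w : Weight n} (hv : v.1 < 0)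
    (hw : w.1 < 0) {le : Mon n → Mon n → Prop} (hle : IsMonomialOrdering le)
    {I : Ideal (MixedRing R n)} (hI : IsXHomogeneous I) {G : Finset (MixedRing R n)}
    (hG : IsInitiallyReducedStandardBasis (weightedOrder w le) I G) :
    initialIdeal v I = initialIdeal w I ↔
      ∀ g ∈ G, topExps (weightLe v) g = topExps (weightLe w) g := by
  obtain ⟨⟨hGI, hlead⟩, -, hred⟩ := hG
  have hW := isTermOrder_weightedOrder hw hle
  unfold IsInitiallyReducedWrt at hred
  rw [hlead] at hred
  refine ⟨fun h g hg => topExps_eq_of_initialIdeal_eq hv hw hle (hGI hg) (hred g hg) h,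
    fun h => ?_⟩
  have hdeg : ∀ g ∈ (G : Set (MixedRing R n)), ∀ p q, tcoeff g p ≠ 0 → tcoeff g q ≠ 0 →
      p.2.degree = q.2.degree := by
    intro g hg p q hp hq
    have hg0 : g ≠ 0 := by
      rintro rfl
      exact hp (tcoeff_zero p)
    obtain ⟨m, hm⟩ := hW.topExps_nonempty hg0
    rw [degree_eq_of_initiallyReduced hW hI (hGI hg) (hred g hg) hm hp,
      degree_eq_of_initiallyReduced hW hI (hGI hg) (hred g hg) hm hq]
  rw [initialIdeal_eq_span hv hle hGI (leadIdeal_eq_of_topExps_eq hv hw hle hI hGI hlead h) hdeg,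
    initialIdeal_eq_span hw hle hGI hlead hdeg]
  refine congrArg Ideal.span (Set.image_congr fun g hg => ?_)
  rw [initialForm, initialForm, topForm, topForm, h g hg]

/-! ### Rational polyhedral cones -/

theorem IsRationalPolyhedralCone.inter {C C' : Set (Weight n)} (h : IsRationalPolyhedralCone C)
    (h' : IsRationalPolyhedralCone C') : IsRationalPolyhedralCone (C ∩ C') := by
  classical
  obtain ⟨A, rfl⟩ := h
  obtain ⟨A', rfl⟩ := h'
  refine ⟨A ∪ A', ?_⟩
  ext v
  simp only [Set.mem_inter_iff, Set.mem_ofPred_eq, Finset.mem_union, or_imp, forall_and]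

theorem isRationalPolyhedralCone_halfspace (a : ℤ × (Fin n → ℤ)) :
    IsRationalPolyhedralCone {v : Weight n | 0 ≤ v.1 * (a.1 : ℝ) + ∑ i, v.2 i * (a.2 i : ℝ)} :=
  ⟨{a}, by simp⟩

theorem isRationalPolyhedralCone_forall_mem {ι : Type*} (s : Finset ι)
    {P : ι → Weight n → Prop} (h : ∀ i ∈ s, IsRationalPolyhedralCone {v | P i v}) :
    IsRationalPolyhedralCone {v | ∀ i ∈ s, P i v} := by
  classical
  induction s using Finset.induction_on with
  | empty => exact ⟨∅, by simp⟩
  | insert i s _ ih =>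
    have := (h i (by simp)).inter (ih fun j hj => h j (by simp [hj]))
    convert! this using 1
    ext v
    simp

theorem IsRationalPolyhedralCone.isClosed {C : Set (Weight n)} (h : IsRationalPolyhedralCone C) :
    IsClosed C := by
  obtain ⟨A, rfl⟩ := h
  simp only [Set.ofPred_forall]
  refine isClosed_biInter fun a _ => isClosed_le continuous_const ?_
  fun_prop

theorem isRationalPolyhedralCone_wdeg_le (p q : Mon n) :
    IsRationalPolyhedralCone {v : Weight n | wdeg v p ≤ wdeg v q} := by
  convert! isRationalPolyhedralCone_halfspace
    (((q.1 : ℤ) - p.1, fun i => (q.2 i : ℤ) - p.2 i) : ℤ × (Fin n → ℤ)) using 1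
  ext v
  simp only [Set.mem_ofPred_eq, wdeg, Int.cast_sub, Int.cast_natCast, mul_sub,
    Finset.sum_sub_distrib]
  constructor <;> intro h <;> linarith

theorem isRationalPolyhedralCone_fst_nonpos :
    IsRationalPolyhedralCone {v : Weight n | v.1 ≤ 0} := by
  convert! isRationalPolyhedralCone_halfspace ((-1, 0) : ℤ × (Fin n → ℤ)) using 1
  ext v
  simp

theorem isRationalPolyhedralCone_fst_eq_zero :
    IsRationalPolyhedralCone {v : Weight n | v.1 = 0} := by
  convert! isRationalPolyhedralCone_fst_nonpos.inter
    (isRationalPolyhedralCone_halfspace ((1, 0) : ℤ × (Fin n → ℤ))) using 1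
  ext v
  simp [le_antisymm_iff]

theorem isRationalPolyhedralCone_satisfiesSystem (w : Weight n) (le : Mon n → Mon n → Prop)
    (G : Finset (MixedRing R n)) : IsRationalPolyhedralCone {v | SatisfiesSystem w le G v} := by
  refine isRationalPolyhedralCone_forall_mem G fun g _ => IsRationalPolyhedralCone.inter ?_ ?_
  · exact isRationalPolyhedralCone_forall_mem _ fun m _ =>
      isRationalPolyhedralCone_forall_mem _ fun p _ => isRationalPolyhedralCone_wdeg_le p m
  · refine isRationalPolyhedralCone_forall_mem _ fun p _ =>
      isRationalPolyhedralCone_forall_mem _ fun q _ => ?_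
    convert! (isRationalPolyhedralCone_wdeg_le p q).inter (isRationalPolyhedralCone_wdeg_le q p)
      using 1
    ext v
    simp [le_antisymm_iff]

/-! ### Gröbner cones -/

theorem wdeg_add_smul (v w : Weight n) (ε : ℝ) (p : Mon n) :
    wdeg (v + ε • w) p = wdeg v p + ε * wdeg w p := by
  simp only [wdeg, Prod.fst_add, Prod.smul_fst, smul_eq_mul, Prod.snd_add, Prod.smul_snd,
    Pi.add_apply, Pi.smul_apply, add_mul, Finset.sum_add_distrib, mul_add, Finset.mul_sum, mul_assoc]
  ring

/-- On `minExps g` the leading monomial maximizes both `v`- and `w`-degree, so a monomial is maximal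
for `v + ε • w` only if it is maximal for `w`; the equations of the system give the converse. Hence
no smallness of `ε` is needed, and `v.1 = 0` is allowed. -/
theorem topExps_add_smul {v w : Weight n} (hv : v.1 ≤ 0) (hw : w.1 < 0)
    {le : Mon n → Mon n → Prop} (hle : IsMonomialOrdering le) {G : Finset (MixedRing R n)}
    (h : SatisfiesSystem w le G v) {ε : ℝ} (hε : 0 < ε) {g : MixedRing R n} (hg : g ∈ G) :
    topExps (weightLe (v + ε • w)) g = topExps (weightLe w) g := by
  have hvw : (v + ε • w).1 < 0 := by
    have := mul_neg_of_pos_of_neg hε hw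
    simp only [Prod.fst_add, Prod.smul_fst, smul_eq_mul]
    linarith
  have hpre := isTermPreorder_weightLe hvw
  have hprew := isTermPreorder_weightLe hw
  by_cases hg0 : g = 0
  · ext m
    rw [hpre.mem_topExps, hprew.mem_topExps]
    simp [hg0]
  obtain ⟨m, hm⟩ := (isTermPreorder_weightedOrder hw hle).topExps_nonempty hg0
  obtain ⟨hsys, hties⟩ := h g hg
  have hmw := ((mem_topExps_weightedOrder hw hle).1 hm).1
  have hmw' := hprew.mem_topExps.1 hmw
  ext p
  constructor
  · intro hp
    have hpmin := topExps_subset_minExps _ _ hp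
    have hp' := hpre.mem_topExps.1 hp
    have h1 : wdeg (v + ε • w) m ≤ wdeg (v + ε • w) p := hp'.2 m hmw'.1
    have h2 := hsys m hm p hpmin
    rw [wdeg_add_smul, wdeg_add_smul] at h1
    have h3 : wdeg w m ≤ wdeg w p := le_of_mul_le_mul_left (by linarith) hε
    exact hprew.mem_topExps.2 ⟨hp'.1, fun q hq => (hmw'.2 q hq).trans h3⟩
  · intro hp
    refine hpre.mem_topExps.2 ⟨(hprew.mem_topExps.1 hp).1, fun q hq => ?_⟩
    obtain ⟨q', hq', -, -, hqq⟩ := hpre.exists_minExps_ge hq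
    refine hpre.trans _ _ _ hqq ?_
    have h1 := hsys m hm q' hq'
    have h2 : wdeg w q' ≤ wdeg w m := hmw'.2 q' ((mem_minExps _ _).1 hq').1
    have h3 := mul_le_mul_of_nonneg_left h2 hε.le
    change wdeg _ _ ≤ wdeg _ _
    rw [wdeg_add_smul, wdeg_add_smul, hties p hp m hmw, wdeg_eq_of_mem_topExps hw hp hmw]
    linarith

theorem groebnerCone_eq [IsNoetherianRing R] {w : Weight n} (hw : w.1 < 0)
    {le : Mon n → Mon n → Prop} (hle : IsMonomialOrdering le) {I : Ideal (MixedRing R n)}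
    (hI : IsXHomogeneous I) {G : Finset (MixedRing R n)}
    (hG : IsInitiallyReducedStandardBasis (weightedOrder w le) I G) :
    groebnerCone I w = {v | v.1 ≤ 0 ∧ SatisfiesSystem w le G v} := by
  refine Set.Subset.antisymm (closure_minimal ?_ ?_) ?_
  · rintro v ⟨hv, heq⟩
    rw [initialIdeal_eq_iff hv hw hle hI hG] at heq
    refine ⟨hv.le, fun g hg => ⟨fun m hm p hp => ?_, fun p hp q hq => ?_⟩⟩
    · have hm' := ((mem_topExps_weightedOrder hw hle).1 hm).1
      rw [← heq g hg, (isTermPreorder_weightLe hv).mem_topExps] at hm'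
      exact hm'.2 p ((mem_minExps _ _).1 hp).1
    · rw [← heq g hg] at hp hq
      exact wdeg_eq_of_mem_topExps hv hp hq
  · exact (isRationalPolyhedralCone_fst_nonpos.inter
      (isRationalPolyhedralCone_satisfiesSystem w le G)).isClosed
  · rintro v ⟨hv, hsys⟩
    have htendsto : Filter.Tendsto (fun ε : ℝ => v + ε • w) (nhdsWithin 0 (Set.Ioi 0)) (nhds v) := by
      have hcont : Continuous fun ε : ℝ => v + ε • w := by fun_prop
      simpa using (hcont.tendsto 0).mono_left nhdsWithin_le_nhds
    refine mem_closure_of_tendsto htendsto ?_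
    filter_upwards [self_mem_nhdsWithin] with ε hε
    have hvw : (v + ε • w).1 < 0 := by
      have := mul_neg_of_pos_of_neg (Set.mem_Ioi.1 hε) hw
      simp only [Prod.fst_add, Prod.smul_fst, smul_eq_mul]
      linarith
    exact ⟨hvw, (initialIdeal_eq_iff hvw hw hle hI hG).2 fun g hg =>
      topExps_add_smul hv hw hle hsys hε hg⟩

theorem boundaryGroebnerCone_eq [IsNoetherianRing R] {w : Weight n} (hw : w.1 < 0)
    {le : Mon n → Mon n → Prop} (hle : IsMonomialOrdering le) {I : Ideal (MixedRing R n)}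
    (hI : IsXHomogeneous I) {G : Finset (MixedRing R n)}
    (hG : IsInitiallyReducedStandardBasis (weightedOrder w le) I G) :
    boundaryGroebnerCone I w = {v | v.1 = 0 ∧ SatisfiesSystem w le G v} := by
  rw [boundaryGroebnerCone, groebnerCone_eq hw hle hI hG]
  ext v
  exact ⟨fun h => ⟨h.2, h.1.2⟩, fun h => ⟨⟨h.1.le, h.2⟩, h.1⟩⟩

/-- The polyhedrality of the cones mentions no ordering, so one must be supplied; lexicographic
comparison will do. -/
theorem exists_isMonomialOrdering (n : ℕ) :
    ∃ le : Mon n → Mon n → Prop, IsMonomialOrdering le := by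
  let e : Mon n → ℕ ×ₗ MonomialOrder.lex.syn := fun p =>
    toLex (p.1, MonomialOrder.lex.toSyn (σ := Fin n) p.2)
  have hadd : ∀ p q, e (p + q) = e p + e q := fun p q => by simp [e, ← toLex_add]
  refine ⟨fun p q => e p ≤ e q, fun _ => le_rfl, fun _ _ _ => le_trans, fun a b h h' => ?_,
    fun _ _ => le_total _ _, fun a b c h => ?_⟩
  · have := le_antisymm h h'
    simpa [e, Prod.ext_iff] using this
  · rw [hadd, hadd]
    exact add_le_add_left h _

end GroebnerFan

end

open GroebnerFan in
theorem proposition3p14 {R : Type*} [CommRing R] [IsNoetherianRing R] {n : ℕ}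
    (I : Ideal (MixedRing R n)) (hI : IsXHomogeneous I) (w : Weight n) (hw : w.1 < 0) :
    (IsClosed (groebnerCone I w) ∧ IsRationalPolyhedralCone (groebnerCone I w)) ∧
    (IsClosed (boundaryGroebnerCone I w) ∧ IsRationalPolyhedralCone (boundaryGroebnerCone I w)) ∧
    ∀ le : Mon n → Mon n → Prop, IsMonomialOrdering le →
      (∃ G : Finset (MixedRing R n),
        IsInitiallyReducedStandardBasis (weightedOrder w le) I G) ∧
      ∀ G : Finset (MixedRing R n),
        IsInitiallyReducedStandardBasis (weightedOrder w le) I G →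
        groebnerCone I w = {v | v.1 ≤ 0 ∧ SatisfiesSystem w le G v} ∧
        boundaryGroebnerCone I w = {v | v.1 = 0 ∧ SatisfiesSystem w le G v} := by
  obtain ⟨le₀, hle₀⟩ := exists_isMonomialOrdering n
  obtain ⟨G₀, hG₀⟩ := exists_isInitiallyReducedStandardBasis hw hle₀ hI
  have hcone : IsRationalPolyhedralCone (groebnerCone I w) := by
    rw [groebnerCone_eq hw hle₀ hI hG₀]
    exact isRationalPolyhedralCone_fst_nonpos.inter
      (isRationalPolyhedralCone_satisfiesSystem w le₀ G₀)
  have hcone' : IsRationalPolyhedralCone (boundaryGroebnerCone I w) :=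
    hcone.inter isRationalPolyhedralCone_fst_eq_zero
  exact ⟨⟨hcone.isClosed, hcone⟩, ⟨hcone'.isClosed, hcone'⟩, fun le hle =>
    ⟨exists_isInitiallyReducedStandardBasis hw hle hI, fun G hG =>
      ⟨groebnerCone_eq hw hle hI hG, boundaryGroebnerCone_eq hw hle hI hG⟩⟩⟩
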